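/- Let $(X,\rho)$ be a compact path-connected metric space of diameter $\pi$, and write $B_t(x)$ for the open ball of radius $t$ about $x$ and $E(x;a,b)=\{y\in X:\ a\le\rho(x,y)\le b\}$. Let $0=t_0<t_1<\cdots<t_\ell=\pi$ and let $r$ be a natural number. Let $\Phi\in C[0,\pi]$ satisfy $$|\Phi(s)-\Phi(s')|\le|s-s'|\qquad\text{for all } s,s'\in[0,\pi],$$ and belong to the class $\mathcal S_r(t_1,\dots,t_\ell)$: there is an $r$-dimensional linear subspace $V_r$ of the space $C(X)$ of real continuous functions on $X$ such that for every $x\in X$ and every $1\le j\le\ell$ the function $\Phi(\rho(x,\cdot))$ coincides on $E(x;t_{j-1},t_j)$ with some element of $V_r$. Let $\beta\ge1$, $c_1>1$, $c_2>1$ be real constants, and let $\mu$ be a non-atomic Borel probability measure on $X$ such that $$\mu(B_t(x))\ \ge\ \Bigl(\frac{8}{c_1}\Bigr)^{\beta}t^{\beta}\qquad\text{for all } x\in X,\ 0<t\le1,$$ and $$\mu\bigl(E(x;t_j-\delta,t_j+\delta)\bigr)\le c_2\,\delta\qquad\text{for all } x\in X,\ \delta\in(0,\pi),\ 1\le j<\ell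 .$$ Then for every real-valued $g\in L^\infty(X,\mu)$ with $\|g\|_{L^\infty(\mu)}\le1$ and every integer $N\ge20$ there exist points $y_1,\dots,y_{2(r+2)N}\in X$ and real numbers $\lambda_1,\dots,\lambda_{2(r+2)N}$ such that $$\max_{x\in X}\Bigl|\int_X\Phi(\rho(x,y))\,g(y)\,d\mu(y)-\sum_{j=1}^{2(r+2)N}\lambda_j\,\Phi(\rho(x,y_j))\Bigr|\ \le\ 45\,c_3\,N^{-\frac12-\frac{3}{2\beta}}\sqrt{\log N},\qquad c_3:=8c_1^2\sqrt{c_2\ell}\,\sqrt{\beta}.$$ -/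

import Mathlib

/-- The closed annulus `E(x; a, b) = {y : a ≤ ρ(x, y) ≤ b}`. -/
def metricAnnulus {X : Type*} [MetricSpace X] (x : X) (a b : ℝ) : Set X :=
  {y : X | a ≤ dist x y ∧ dist x y ≤ b}

/-- `0 = t₀ < t₁ < ⋯ < t_ℓ = π` (this forces `ℓ ≥ 1`). -/
structure IsPartitionZeroPi {l : ℕ} (t : Fin (l + 1) → ℝ) : Prop where
  zero : t 0 = 0
  last : t (Fin.last l) = Real.pi
  strictMono : StrictMono t

/-- `Φ ∈ C[0, π]` (given as a function on `ℝ` of which only the values on `[0, π]` matter) belongs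
to the class `𝒮_r(t₁, …, t_ℓ)` of the metric space `X`: for one `r`-dimensional linear subspace
`V` of `C(X)`, each `Φ(ρ(x, ·))` agrees on each annulus `E(x; t_{j-1}, t_j)` with an element
of `V`. -/
def MemClassS (X : Type*) [MetricSpace X] (r : ℕ) {l : ℕ} (t : Fin (l + 1) → ℝ)
    (Φ : ℝ → ℝ) : Prop :=
  ContinuousOn Φ (Set.Icc 0 Real.pi) ∧
  ∃ V : Submodule ℝ C(X, ℝ), FiniteDimensional ℝ V ∧ Module.finrank ℝ V = r ∧
    ∀ (x : X) (j : Fin l), ∃ f ∈ V, ∀ y ∈ metricAnnulus x (t j.castSucc) (t j.succ),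
      Φ (dist x y) = f y

open MeasureTheory

/-! Splitting `g` into positive and negative parts reduces the claim to a measure `ν ≤ μ`. Cover `X`
by at most `N / 2` compact sets of diameter at most `δ = c₁ * N ^ (-1 / β)`, make them disjoint, and
cut `ν` into at most `N` pieces, each carried by one cell and of mass at most `2 / N`. Replace each
piece by `r + 1` weighted nodes in its compact set, exact on `V_r` and on constants.

Fix `x`. A cell lying in one annulus about `x` causes no error, since the kernel agrees there with
an element of `V_r`. Only cells near a sphere of radius `t j` matter; their total mass is at most `l
* c₂ * δ`, and a piece there costs at most `2 * δ` times its mass. Adding these costs gives only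
order `δ ^ 2`. The gain comes from choosing the rules at random with the right mean, which is
possible because the vector of exact integrals lies in the convex hull of the quadrature values
(`integral_mem_convexHull_quadratureValues`). Hoeffding's inequality then involves a sum of squares
of at most `4 * δ ^ 2 * (2 / N) * (l * c₂ * δ)`, whose root is of order `N ^ (-1/2 - 3/(2β))`.

The logarithm pays for a union bound over a net of at most `N ^ (β/2 + 3/2)` centres, fine enough
for the Lipschitz bound to reach every `x`. The random choice is made deterministically, one piece
at a time, by controlling an exponential potential (`exists_selection_abs_sum_le`). -/

/-! ### Padding with zero weights, and finite quadrature by Carathéodory -/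

theorem sum_extend_smul_extend {ι κ X E : Type*} [Fintype ι] [Fintype κ] [AddCommGroup E]
    [Module ℝ E] (e : ι ↪ κ) (w : ι → ℝ) (y : ι → X) (x₀ : X) (f : X → E) :
    ∑ k, Function.extend e w 0 k • f (Function.extend e y (fun _ => x₀) k) =
      ∑ i, w i • f (y i) := by
  symm
  refine Fintype.sum_of_injective e e.injective _ _ ?_ ?_
  · intro k hk
    rw [Function.extend_apply' _ _ _ (by simpa using hk)]
    simp
  · intro i
    rw [e.injective.extend_apply, e.injective.extend_apply]

theorem extend_nonneg {ι κ : Type*} (e : ι ↪ κ) {w : ι → ℝ} (hw : 0 ≤ w) :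
    0 ≤ Function.extend e w 0 := by
  intro k
  by_cases hk : ∃ i, e i = k
  · obtain ⟨i, rfl⟩ := hk
    rw [e.injective.extend_apply]
    exact hw i
  · rw [Function.extend_apply' _ _ _ hk]

theorem extend_mem {ι κ X : Type*} (e : ι ↪ κ) {y : ι → X} {x₀ : X} {D : Set X}
    (hy : ∀ i, y i ∈ D) (hx₀ : x₀ ∈ D) (k : κ) : Function.extend e y (fun _ => x₀) k ∈ D := by
  by_cases hk : ∃ i, e i = k
  · obtain ⟨i, rfl⟩ := hk
    rw [e.injective.extend_apply]
    exact hy i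
  · rw [Function.extend_apply' _ _ _ hk]
    exact hx₀

/-- By Carathéodory, `finrank + 1` points suffice, so the hull is a continuous image of a simplex
times a power of `s`. This makes the hull closed, so that averages lie in it. -/
theorem IsCompact.convexHull_of_finiteDimensional {E : Type*} [NormedAddCommGroup E]
    [NormedSpace ℝ E] [FiniteDimensional ℝ E] {s : Set E} (hs : IsCompact s) :
    IsCompact (convexHull ℝ s) := by
  set d := Module.finrank ℝ E + 1
  have hK : IsCompact (stdSimplex ℝ (Fin d) ×ˢ Set.univ.pi fun _ : Fin d => s) :=
    (isCompact_stdSimplex ℝ (Fin d)).prod (isCompact_univ_pi fun _ => hs)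
  have hc : Continuous fun p : (Fin d → ℝ) × (Fin d → E) => ∑ i, p.1 i • p.2 i := by fun_prop
  convert hK.image hc using 1
  ext x
  constructor
  · intro hx
    rw [convexHull_eq_union] at hx
    simp only [Set.mem_iUnion] at hx
    obtain ⟨t, hts, hind, hxt⟩ := hx
    have hcard : Fintype.card t ≤ Fintype.card (Fin d) := by
      have := hind.card_le_finrank_succ
      have h2 : Module.finrank ℝ (vectorSpan ℝ (Set.range ((↑) : t → E))) ≤
        Module.finrank ℝ E := Submodule.finrank_le _
      simp only [Fintype.card_fin, d]
      omega
    obtain ⟨e⟩ := Function.Embedding.nonempty_of_card_le hcard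
    obtain ⟨x₀, hx₀⟩ : t.Nonempty := by
      rw [← Finset.coe_nonempty, ← convexHull_nonempty_iff (𝕜 := ℝ)]
      exact ⟨x, hxt⟩
    rw [Finset.mem_convexHull'] at hxt
    obtain ⟨w, hw0, hw1, hwx⟩ := hxt
    refine ⟨(Function.extend e (fun i : t => w i) 0,
      Function.extend e (fun i : t => (i : E)) fun _ => x₀), ⟨⟨?_, ?_⟩, ?_⟩, ?_⟩
    · exact extend_nonneg e fun i => hw0 i i.2
    · have := sum_extend_smul_extend e (fun i : t => w i) (fun i : t => (i : E)) x₀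
        fun _ => (1 : ℝ)
      simp only [smul_eq_mul, mul_one] at this
      rw [this, ← hw1, ← Finset.sum_coe_sort t w]
    · intro k _
      exact extend_mem e (fun i => hts i.2) (hts hx₀) k
    · have := sum_extend_smul_extend e (fun i : t => w i) (fun i : t => (i : E)) x₀ id
      simp only [id] at this
      simp only
      rw [this, ← hwx, ← Finset.sum_coe_sort t fun i => w i • i]
  · rintro ⟨⟨w, z⟩, ⟨⟨hw0, hw1⟩, hz⟩, rfl⟩
    exact (convex_convexHull ℝ s).sum_mem (fun i _ => hw0 i) hw1
      fun i _ => subset_convexHull ℝ s (hz i trivial)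

/-- Exact finite quadrature for finitely many continuous functions. -/
theorem exists_finite_quadrature {X E : Type*} [TopologicalSpace X] [CompactSpace X]
    [MeasurableSpace X] [BorelSpace X] [NormedAddCommGroup E] [NormedSpace ℝ E]
    [FiniteDimensional ℝ E] (ν : Measure X) [IsFiniteMeasure ν] {D : Set X} (hD : IsCompact D)
    (hDne : D.Nonempty) (hν : ∀ᵐ z ∂ν, z ∈ D) {Ψ : X → E} (hΨ : Continuous Ψ) :
    ∃ (m : ℕ) (y : Fin m → X) (w : Fin m → ℝ), (∀ i, y i ∈ D) ∧ 0 ≤ w ∧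
      ∑ i, w i = ν.real Set.univ ∧ ∑ i, w i • Ψ (y i) = ∫ z, Ψ z ∂ν := by
  by_cases hν0 : ν = 0
  · exact ⟨0, Fin.elim0, 0, fun i => i.elim0, le_rfl, by simp [hν0], by simp [hν0]⟩
  have : NeZero ν := ⟨by exact hν0⟩
  obtain ⟨x₀, hx₀⟩ := hDne
  have : Nonempty X := ⟨x₀⟩
  have hint : Integrable Ψ ν :=
    hΨ.integrable_of_hasCompactSupport (HasCompactSupport.of_compactSpace Ψ)
  have hmem : (⨍ z, Ψ z ∂ν) ∈ convexHull ℝ (Ψ '' D) := by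
    refine (convex_convexHull ℝ _).average_mem
      (hD.image hΨ).convexHull_of_finiteDimensional.isClosed ?_ hint
    filter_upwards [hν] with z hz
    exact subset_convexHull ℝ _ ⟨z, hz, rfl⟩
  rw [convexHull_eq] at hmem
  obtain ⟨ι, t, w, z, hw0, hw1, hz, hc⟩ := hmem
  rw [Finset.centerMass_eq_of_sum_1 _ _ hw1] at hc
  choose! y hyD hyz using hz
  have e := t.equivFin.symm
  have hpos : 0 < ν.real Set.univ :=
    ENNReal.toReal_pos (by simpa using hν0) (measure_ne_top _ _)
  refine ⟨t.card, fun i => y (e i), fun i => ν.real Set.univ * w (e i),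
    fun i => hyD _ (e i).2, fun i => mul_nonneg hpos.le (hw0 _ (e i).2), ?_, ?_⟩
  · rw [← Finset.mul_sum, e.sum_comp fun i => w i, Finset.sum_coe_sort t w, hw1, mul_one]
  · simp_rw [mul_smul]
    rw [← Finset.smul_sum, e.sum_comp fun i => w i • Ψ (y i),
      Finset.sum_coe_sort t fun i => w i • Ψ (y i),
      Finset.sum_congr rfl fun i hi => by rw [hyz i hi], hc, average_eq, smul_smul,
      mul_inv_cancel₀ hpos.ne', one_smul]

/-! ### Splitting weights into mixtures of small support -/

section Mixture

variable {ι M : Type*} [Fintype ι] [AddCommGroup M] [Module ℝ M]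

/-- Move from `w` along `u` until the first coordinate vanishes; the step is the smallest ratio `w i
/ (-u i)` over the decreasing coordinates. -/
theorem exists_smaller_support [DecidableEq ι] {w u : ι → ℝ} (hw : 0 ≤ w)
    (hsupp : ∀ i, w i = 0 → u i = 0) (hneg : ∃ i, u i < 0) :
    ∃ s : ℝ, 0 < s ∧ 0 ≤ w + s • u ∧
      (Finset.univ.filter fun i => (w + s • u) i ≠ 0).card <
        (Finset.univ.filter fun i => w i ≠ 0).card := by
  have hne : (Finset.univ.filter fun i => u i < 0).Nonempty := by
    obtain ⟨i, hi⟩ := hneg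
    exact ⟨i, by simpa⟩
  obtain ⟨k, hk, hmin⟩ := Finset.exists_min_image _ (fun i => w i / (-u i)) hne
  simp only [Finset.mem_filter, Finset.mem_univ, true_and] at hk hmin
  have hwk : 0 < w k := lt_of_le_of_ne (hw k) fun h => by
    have := hsupp k h.symm
    linarith
  have hs : 0 < w k / (-u k) := div_pos hwk (by linarith)
  refine ⟨w k / (-u k), hs, ?_, ?_⟩
  · intro i
    simp only [Pi.zero_apply, Pi.add_apply, Pi.smul_apply, smul_eq_mul]
    rcases lt_or_ge (u i) 0 with h | h
    · have := (le_div_iff₀ (by linarith)).1 (hmin i h)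
      linarith
    · have := hw i
      simp only [Pi.zero_apply] at this
      positivity
  · apply Finset.card_lt_card
    rw [Finset.ssubset_iff_of_subset]
    · refine ⟨k, by simpa using hwk.ne', ?_⟩
      have : u k ≠ 0 := hk.ne
      simp only [Pi.add_apply, Pi.smul_apply, smul_eq_mul, Finset.mem_filter, Finset.mem_univ,
        true_and, not_not]
      field_simp
      ring
    · intro i
      simp only [Pi.add_apply, Pi.smul_apply, smul_eq_mul, Finset.mem_filter, Finset.mem_univ,
        true_and]
      intro h h0
      exact h (by rw [h0, hsupp i h0]; simp)

/-- A nonnegative weight is a mixture of nonnegative weights of small support with the same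
moments. -/
theorem mem_convexHull_small_support [FiniteDimensional ℝ M] (L : (ι → ℝ) →ₗ[ℝ] M)
    (hL : ∀ u, L u = 0 → ∑ i, u i = 0) {w : ι → ℝ} (hw : 0 ≤ w) :
    w ∈ convexHull ℝ {v : ι → ℝ | 0 ≤ v ∧ L v = L w ∧
      (Finset.univ.filter fun i => v i ≠ 0).card ≤ Module.finrank ℝ M} := by
  classical
  induction hn : (Finset.univ.filter fun i => w i ≠ 0).card using Nat.strong_induction_on
    generalizing w with
  | _ n ih =>
  subst hn
  by_cases hcard : (Finset.univ.filter fun i => w i ≠ 0).card ≤ Module.finrank ℝ M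
  · exact subset_convexHull ℝ _ ⟨hw, rfl, hcard⟩
  set T := {i // w i ≠ 0}
  let ex : (T → ℝ) →ₗ[ℝ] (ι → ℝ) := Function.ExtendByZero.linearMap ℝ ((↑) : T → ι)
  have hex : ∀ (v : T → ℝ) (i : T), ex v i = v i := fun v i =>
    Subtype.val_injective.extend_apply _ _ _
  have hex0 : ∀ (v : T → ℝ) (i : ι), w i = 0 → ex v i = 0 := fun v i hi =>
    Function.extend_apply' _ _ _ (by rintro ⟨a, rfl⟩; exact a.2 hi)
  -- More support points than moments: some nonzero direction within the support preserves all
  -- moments. Its coordinates sum to zero, so it has both signs and both rays from `w` lose a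
  -- support point.
  have hker : LinearMap.ker (L ∘ₗ ex) ≠ ⊥ := by
    apply LinearMap.ker_ne_bot_of_finrank_lt
    rw [Module.finrank_fintype_fun_eq_card, Fintype.card_subtype]
    omega
  obtain ⟨v, hvk, hv0⟩ := (Submodule.ne_bot_iff _).1 hker
  set u := ex v with hu
  have hLu : L u = 0 := by simpa using hvk
  have hsum := hL u hLu
  obtain ⟨i₀, hi₀⟩ : ∃ i, u i ≠ 0 := by
    by_contra! h
    exact hv0 (funext fun i => by rw [← hex v i, ← hu, h]; rfl)
  have hneg : ∃ i, u i < 0 := by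
    by_contra! h
    exact hi₀ ((Finset.sum_eq_zero_iff_of_nonneg fun i _ => h i).1 hsum i₀ (Finset.mem_univ _))
  have hpos : ∃ i, (-u) i < 0 := by
    by_contra! h
    have h' : ∑ i, (-u) i = 0 := by simp [hsum]
    have := (Finset.sum_eq_zero_iff_of_nonneg fun i _ => h i).1 h' i₀ (Finset.mem_univ _)
    exact hi₀ (by simpa using this)
  obtain ⟨s, hs, hs0, hsc⟩ := exists_smaller_support hw (hex0 v) hneg
  obtain ⟨s', hs', hs0', hsc'⟩ := exists_smaller_support hw
    (u := -u) (fun i hi => by simp [hu, hex0 v i hi]) hpos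
  have h1 := ih _ hsc hs0 rfl
  have h2 := ih _ hsc' hs0' rfl
  have hL1 : L (w + s • u) = L w := by simp [hLu]
  have hL2 : L (w + s' • -u) = L w := by simp [hLu]
  rw [hL1] at h1
  rw [hL2] at h2
  refine (convex_convexHull ℝ _).segment_subset h1 h2 ?_
  -- These weights cancel the displacements `s • u` and `s' • -u`.
  refine ⟨s' / (s + s'), s / (s + s'), by positivity, by positivity, by field_simp; ring, ?_⟩
  ext i
  simp only [Pi.add_apply, Pi.smul_apply, smul_eq_mul, Pi.neg_apply]
  field_simp
  ring

end Mixture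

/-! ### Random quadrature rules with the right mean -/

/-- The vectors `(∑ i, w i * F p (y i))_p` given by the quadrature rules with `d` nodes in `D` that
have the mass of `ν` and integrate all `φ j` exactly. -/
def quadratureValues {X P : Type*} [TopologicalSpace X] [MeasurableSpace X] {r : ℕ} (d : ℕ)
    (ν : Measure X) (D : Set X) (φ : Fin r → C(X, ℝ)) (F : P → C(X, ℝ)) : Set (P → ℝ) :=
  {q | ∃ (y : Fin d → X) (w : Fin d → ℝ), (∀ i, y i ∈ D) ∧ 0 ≤ w ∧
    ∑ i, w i = ν.real Set.univ ∧ (∀ j, ∑ i, w i * φ j (y i) = ∫ z, φ j z ∂ν) ∧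
    ∀ p, ∑ i, w i * F p (y i) = q p}

theorem integral_mem_convexHull_quadratureValues {X P : Type*} [TopologicalSpace X]
    [CompactSpace X] [MeasurableSpace X] [BorelSpace X] [Fintype P] {r : ℕ} (ν : Measure X)
    [IsFiniteMeasure ν] {D : Set X} (hD : IsCompact D) (hDne : D.Nonempty)
    (hν : ∀ᵐ z ∂ν, z ∈ D) (φ : Fin r → C(X, ℝ)) (F : P → C(X, ℝ)) :
    (fun p => ∫ z, F p z ∂ν) ∈ convexHull ℝ (quadratureValues (r + 1) ν D φ F) := by
  classical
  have hint : ∀ f : C(X, ℝ), Integrable f ν := fun f =>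
    f.continuous.integrable_of_hasCompactSupport (HasCompactSupport.of_compactSpace f)
  let Ψ : X → (Fin r → ℝ) × (P → ℝ) := fun z => (fun j => φ j z, fun p => F p z)
  have hΨ : Continuous Ψ := by fun_prop
  -- This rule is exact for `φ` and `F` together, with no control on `m`. Splitting it while
  -- preserving only the `φ` moments brings the node count down to `r + 1`, independent of `P`;
  -- exactness on `F` survives as the mean.
  obtain ⟨m, y, w, hy, hw, hw1, hwΨ⟩ := exists_finite_quadrature ν hD hDne hν hΨ
  have hΨint : Integrable Ψ ν :=
    hΨ.integrable_of_hasCompactSupport (HasCompactSupport.of_compactSpace Ψ)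
  have hφ : ∀ j, ∑ i, w i * φ j (y i) = ∫ z, φ j z ∂ν := fun j => by
    have h := congrArg
      (((ContinuousLinearMap.proj j).comp (ContinuousLinearMap.fst ℝ _ _) :
        (Fin r → ℝ) × (P → ℝ) →L[ℝ] ℝ)) hwΨ
    rw [← ContinuousLinearMap.integral_comp_comm _ hΨint, map_sum] at h
    simpa [Ψ] using h
  have hF : ∀ p, ∑ i, w i * F p (y i) = ∫ z, F p z ∂ν := fun p => by
    have h := congrArg
      (((ContinuousLinearMap.proj p).comp (ContinuousLinearMap.snd ℝ _ _) :
        (Fin r → ℝ) × (P → ℝ) →L[ℝ] ℝ)) hwΨ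
    rw [← ContinuousLinearMap.integral_comp_comm _ hΨint, map_sum] at h
    simpa [Ψ] using h
  let L : (Fin m → ℝ) →ₗ[ℝ] (Fin (r + 1) → ℝ) := LinearMap.pi
    -- The total mass is moment `0`: hence `r + 1`, and kernel vectors sum to zero.
    (Fin.cons (∑ i, LinearMap.proj i) fun j => ∑ i, φ j (y i) • LinearMap.proj i)
  have hL0 : ∀ u, L u 0 = ∑ i, u i := fun u => by simp [L]
  have hLs : ∀ u j, L u (Fin.succ j) = ∑ i, u i * φ j (y i) := fun u j => by
    simp [L, mul_comm]
  let Q : (Fin m → ℝ) →ₗ[ℝ] (P → ℝ) := LinearMap.pi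
    fun p => ∑ i, F p (y i) • LinearMap.proj i
  have hQ : ∀ u p, Q u p = ∑ i, u i * F p (y i) := fun u p => by simp [Q, mul_comm]
  have hmem := mem_convexHull_small_support L
    (fun u hu => by rw [← hL0, hu]; rfl) hw
  have hmemQ := Set.mem_image_of_mem Q hmem
  rw [Q.image_convexHull] at hmemQ
  have hQw : Q w = fun p => ∫ z, F p z ∂ν := funext fun p => by rw [hQ, hF]
  rw [hQw] at hmemQ
  refine convexHull_mono ?_ hmemQ
  rintro _ ⟨v, ⟨hv0, hLv, hvc⟩, rfl⟩
  obtain ⟨x₀, hx₀⟩ := hDne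
  rw [Module.finrank_fin_fun] at hvc
  have hcard : Fintype.card {i // v i ≠ 0} ≤ Fintype.card (Fin (r + 1)) := by
    rwa [Fintype.card_subtype, Fintype.card_fin]
  obtain ⟨e⟩ := Function.Embedding.nonempty_of_card_le hcard
  have hsum : ∀ f : X → ℝ, ∑ k, Function.extend e (fun i : {i // v i ≠ 0} => v i) 0 k *
      f (Function.extend e (fun i : {i // v i ≠ 0} => y i) (fun _ => x₀) k) =
      ∑ i, v i * f (y i) := fun f => by
    have := sum_extend_smul_extend e (fun i : {i // v i ≠ 0} => v i)
      (fun i : {i // v i ≠ 0} => y i) x₀ f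
    simp only [smul_eq_mul] at this
    rw [this]
    refine Fintype.sum_of_injective _ Subtype.val_injective _ _ (fun i hi => ?_) fun _ => rfl
    have : v i = 0 := by
      by_contra h
      exact hi ⟨⟨i, h⟩, rfl⟩
    simp [this]
  refine ⟨_, _, fun k => extend_mem e (fun i => hy i) hx₀ k,
    extend_nonneg e fun i => hv0 i, ?_, fun j => ?_, fun p => ?_⟩
  · have := hsum fun _ => 1
    simp only [mul_one] at this
    rw [this, ← hL0, hLv, hL0, hw1]
  · rw [hsum, ← hLs, hLv, hLs, hφ]
  · rw [hsum, hQ]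

/-! ### Derandomized Hoeffding inequality -/

/-- Convexity puts `exp` below its chord over `[-b, b]`. Since this bound is affine in `h`, its mean
involves only the mean of `h`. -/
theorem exp_le_cosh_add {h b : ℝ} (hb : |h| ≤ b) :
    Real.exp h ≤ Real.cosh b + h * (Real.sinh b / b) := by
  obtain ⟨h1, h2⟩ := abs_le.1 hb
  rcases (abs_nonneg h |>.trans hb).eq_or_lt with h0 | h0
  · subst h0
    have : h = 0 := by linarith
    simp [this]
  have := convexOn_exp.2 (Set.mem_univ b) (Set.mem_univ (-b))
    (show 0 ≤ (b + h) / (2 * b) from div_nonneg (by linarith) (by linarith))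
    (show 0 ≤ (b - h) / (2 * b) from div_nonneg (by linarith) (by linarith))
    (by field_simp; ring)
  simp only [smul_eq_mul] at this
  have e1 : (b + h) / (2 * b) * b + (b - h) / (2 * b) * -b = h := by field_simp; ring
  rw [e1] at this
  refine this.trans (le_of_eq ?_)
  rw [Real.cosh_eq, Real.sinh_eq]
  field_simp
  ring

/-- Derandomized Hoeffding step: a point of the convex hull can be replaced by a point of the set
without increasing the exponential potential by more than the subgaussian factor. -/
theorem exists_mem_sum_exp_le {P : Type*} [Fintype P] {S : Set (P → ℝ)} {m b : P → ℝ}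
    (hm : m ∈ convexHull ℝ S) (hb : ∀ q ∈ S, ∀ p, |q p - m p| ≤ b p) (ε : P → ℝ)
    (c : P → ℝ) (hc : 0 ≤ c) :
    ∃ q ∈ S, ∑ p, c p * Real.exp (ε p * (q p - m p)) ≤
      ∑ p, c p * Real.exp ((ε p * b p) ^ 2 / 2) := by
  let A : (P → ℝ) →ₗ[ℝ] ℝ := ∑ p, (c p * (Real.sinh (|ε p| * b p) / (|ε p| * b p)) * ε p) •
    LinearMap.proj p
  have hA : ∀ q, A q = ∑ p, c p * (Real.sinh (|ε p| * b p) / (|ε p| * b p)) * ε p * q p :=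
    fun q => by simp [A]
  -- Otherwise `S`, hence its hull, would lie in the open half-space `A m < A q`, which omits `m`.
  obtain ⟨q, hq, hle⟩ : ∃ q ∈ S, A q ≤ A m := by
    by_contra! h
    have hconv : Convex ℝ {q | A m < A q} := convex_halfSpace_gt A.isLinear _
    have hmm : m ∈ {q | A m < A q} := convexHull_min (fun q hq => h q hq) hconv hm
    exact lt_irrefl (A m) hmm
  refine ⟨q, hq, ?_⟩
  calc ∑ p, c p * Real.exp (ε p * (q p - m p))
      ≤ ∑ p, (c p * Real.cosh (|ε p| * b p) +
          c p * (Real.sinh (|ε p| * b p) / (|ε p| * b p)) * ε p * (q p - m p)) := by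
        refine Finset.sum_le_sum fun p _ => ?_
        have := exp_le_cosh_add (h := ε p * (q p - m p)) (b := |ε p| * b p) (by
          rw [abs_mul]
          exact mul_le_mul_of_nonneg_left (hb q hq p) (abs_nonneg _))
        have := mul_le_mul_of_nonneg_left this (hc p)
        linarith
    _ = ∑ p, c p * Real.cosh (|ε p| * b p) + (A q - A m) := by
        rw [Finset.sum_add_distrib, hA, hA, ← Finset.sum_sub_distrib]
        congr 1
        exact Finset.sum_congr rfl fun p _ => by ring
    _ ≤ ∑ p, c p * Real.cosh (|ε p| * b p) := by linarith
    _ ≤ _ := by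
        refine Finset.sum_le_sum fun p _ => mul_le_mul_of_nonneg_left ?_ (hc p)
        refine (Real.cosh_le_exp_half_sq _).trans (le_of_eq ?_)
        rw [mul_pow, mul_pow, sq_abs]

/-- Method of conditional expectations: the indices are settled one by one, and the weights `c`
carry the factors of the others. -/
theorem exists_selection_sum_exp_le {ι P : Type*} [Fintype P] (s : Finset ι)
    {S : ι → Set (P → ℝ)} {m b : ι → P → ℝ} (hm : ∀ i, m i ∈ convexHull ℝ (S i))
    (hb : ∀ i, ∀ q ∈ S i, ∀ p, |q p - m i p| ≤ b i p) (ε c : P → ℝ) (hc : 0 ≤ c) :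
    ∃ q : ι → P → ℝ, (∀ i, q i ∈ S i) ∧
      ∑ p, c p * Real.exp (ε p * ∑ i ∈ s, (q i p - m i p)) ≤
        ∑ p, c p * Real.exp (ε p ^ 2 * (∑ i ∈ s, b i p ^ 2) / 2) := by
  classical
  induction s using Finset.induction_on generalizing c with
  | empty =>
    choose q hq using fun i => convexHull_nonempty_iff.1 ⟨_, hm i⟩
    exact ⟨q, hq, by simp⟩
  | insert a s ha ih =>
    obtain ⟨q, hq, hle⟩ := ih (fun p => c p * Real.exp ((ε p * b a p) ^ 2 / 2))
      fun p => mul_nonneg (hc p) (Real.exp_pos _).le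
    obtain ⟨v, hv, hvle⟩ := exists_mem_sum_exp_le (hm a) (hb a) ε
      (fun p => c p * Real.exp (ε p * ∑ i ∈ s, (q i p - m i p)))
      fun p => mul_nonneg (hc p) (Real.exp_pos _).le
    refine ⟨Function.update q a v, fun i => ?_, ?_⟩
    · by_cases h : i = a
      · subst h
        simpa using hv
      · simpa [h] using hq i
    · have hs : ∀ p, ∑ i ∈ s, (Function.update q a v i p - m i p) =
          ∑ i ∈ s, (q i p - m i p) := fun p => Finset.sum_congr rfl fun i hi => by
        rw [Function.update_of_ne (by rintro rfl; exact ha hi)]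
      simp only [Finset.sum_insert ha, hs, Function.update_self]
      calc _ = ∑ p, c p * Real.exp (ε p * ∑ i ∈ s, (q i p - m i p)) *
            Real.exp (ε p * (v p - m a p)) := Finset.sum_congr rfl fun p _ => by
              rw [mul_assoc, ← Real.exp_add]
              congr 2
              ring
        _ ≤ _ := hvle
        _ = ∑ p, c p * Real.exp ((ε p * b a p) ^ 2 / 2) *
            Real.exp (ε p * ∑ i ∈ s, (q i p - m i p)) := Finset.sum_congr rfl fun p _ => by ring
        _ ≤ _ := hle
        _ = _ := Finset.sum_congr rfl fun p _ => by
              rw [mul_assoc, ← Real.exp_add]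
              congr 2
              ring

/-- Derandomized Hoeffding inequality with a union bound. -/
theorem exists_selection_abs_sum_le {ι P : Type*} [Fintype ι] [Fintype P]
    {S : ι → Set (P → ℝ)} {m b : ι → P → ℝ} (hm : ∀ i, m i ∈ convexHull ℝ (S i))
    (hb : ∀ i, ∀ q ∈ S i, ∀ p, |q p - m i p| ≤ b i p) {B Λ : ℝ} (hB : 0 < B) (hΛ : 0 < Λ)
    (hbB : ∀ p, ∑ i, b i p ^ 2 ≤ B ^ 2) (hP : 2 * (Fintype.card P : ℝ) ≤ Real.exp Λ) :
    ∃ q : ι → P → ℝ, (∀ i, q i ∈ S i) ∧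
      ∀ p, |∑ i, (q i p - m i p)| ≤ Real.sqrt (2 * Λ) * B := by
  classical
  set R := Real.sqrt (2 * Λ) with hR
  have hR0 : 0 < R := Real.sqrt_pos.2 (by linarith)
  have hR2 : R ^ 2 = 2 * Λ := Real.sq_sqrt (by linarith)
  -- Each coordinate is doubled with a sign to bound the absolute value.
  let S' : ι → Set (P × Bool → ℝ) := fun i => (fun q pb => q pb.1) '' S i
  have hm' : ∀ i, (fun pb : P × Bool => m i pb.1) ∈ convexHull ℝ (S' i) := fun i => by
    have := Set.mem_image_of_mem (LinearMap.funLeft ℝ ℝ (Prod.fst : P × Bool → P)) (hm i)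
    rwa [LinearMap.image_convexHull] at this
  let σ : Bool → ℝ := fun t => if t then 1 else -1
  have hσ : ∀ t, σ t ^ 2 = 1 := by intro t; cases t <;> simp [σ]
  obtain ⟨q', hq', hle⟩ := exists_selection_sum_exp_le Finset.univ hm'
    (b := fun i pb => b i pb.1)
    (by rintro i _ ⟨q, hq, rfl⟩ pb; exact hb i q hq pb.1)
    (fun pb => σ pb.2 * (R / B)) 1 zero_le_one
  choose q hq hqq using hq'
  refine ⟨q, hq, fun p => ?_⟩
  simp only [← hqq, Pi.one_apply, one_mul] at hle
  have hub : ∑ pb : P × Bool, Real.exp ((σ pb.2 * (R / B)) ^ 2 *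
      (∑ i, b i pb.1 ^ 2) / 2) ≤ Real.exp (2 * Λ) := by
    calc _ ≤ ∑ pb : P × Bool, Real.exp Λ := by
          refine Finset.sum_le_sum fun pb _ => Real.exp_le_exp.2 ?_
          rw [mul_pow, hσ, one_mul, div_pow, hR2]
          have := mul_le_mul_of_nonneg_left (hbB pb.1)
            (show 0 ≤ 2 * Λ / B ^ 2 by positivity)
          rw [div_mul_cancel₀ _ (by positivity)] at this
          linarith
      _ = 2 * (Fintype.card P : ℝ) * Real.exp Λ := by
          simp [mul_comm]
      _ ≤ Real.exp Λ * Real.exp Λ := mul_le_mul_of_nonneg_right hP (Real.exp_pos _).le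
      _ = _ := by rw [← Real.exp_add]; congr 1; ring
  -- A single term of the potential is at most `exp (2 * Λ) = exp (R ^ 2)`; dividing the exponent by
  -- `R / B` gives `R * B`.
  have key : ∀ t, σ t * ∑ i, (q i p - m i p) ≤ R * B := fun t => by
    have h1 := (Finset.single_le_sum (f := fun pb : P × Bool =>
      Real.exp (σ pb.2 * (R / B) * ∑ i, (q i pb.1 - m i pb.1)))
      (fun pb _ => (Real.exp_pos _).le) (Finset.mem_univ (p, t))).trans (hle.trans hub)
    have h2 := Real.exp_le_exp.1 h1
    simp only [← hR2] at h2
    have h3 : (R / B) * (σ t * ∑ i, (q i p - m i p)) ≤ (R / B) * (R * B) := by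
      calc _ = σ t * (R / B) * ∑ i, (q i p - m i p) := by ring
        _ ≤ R ^ 2 := h2
        _ = _ := by field_simp
    exact le_of_mul_le_mul_left h3 (by positivity)
  rw [abs_le]
  have h1 := key true
  have h2 := key false
  simp only [σ, if_true, Bool.false_eq_true, if_false] at h1 h2
  constructor <;> linarith

/-! ### Discretizing a measure cell by cell -/

section Discretization

variable {X P : Type*} [TopologicalSpace X] [CompactSpace X] [MeasurableSpace X] [BorelSpace X]
  {r d : ℕ}

theorem ContinuousMap.integrable_of_compactSpace (ν : Measure X) [IsFiniteMeasure ν]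
    (f : C(X, ℝ)) : Integrable f ν :=
  f.continuous.integrable_of_hasCompactSupport (HasCompactSupport.of_compactSpace f)

/-- Both the rule and the integral are within `δ` times the mass of the value at one point of `D`
times the mass. -/
theorem abs_quadratureValues_sub_integral_le {ν : Measure X} [IsFiniteMeasure ν] {D : Set X}
    (hDne : D.Nonempty) (hν : ∀ᵐ z ∂ν, z ∈ D) {φ : Fin r → C(X, ℝ)} {F : P → C(X, ℝ)} {q : P → ℝ}
    (hq : q ∈ quadratureValues d ν D φ F) {p : P} {δ : ℝ}
    (hF : ∀ y ∈ D, ∀ y' ∈ D, |F p y - F p y'| ≤ δ) :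
    |q p - ∫ z, F p z ∂ν| ≤ 2 * δ * ν.real Set.univ := by
  obtain ⟨y, w, hy, hw, hw1, -, hqp⟩ := hq
  obtain ⟨x₀, hx₀⟩ := hDne
  have h1 : |q p - F p x₀ * ν.real Set.univ| ≤ δ * ν.real Set.univ := by
    rw [← hqp, ← hw1, Finset.mul_sum, Finset.mul_sum, ← Finset.sum_sub_distrib]
    refine (Finset.abs_sum_le_sum_abs _ _).trans (Finset.sum_le_sum fun i _ => ?_)
    rw [show w i * F p (y i) - F p x₀ * w i = (F p (y i) - F p x₀) * w i by ring, abs_mul,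
      abs_of_nonneg (hw i)]
    exact mul_le_mul_of_nonneg_right (hF _ (hy i) _ hx₀) (hw i)
  have h2 : |(∫ z, F p z ∂ν) - F p x₀ * ν.real Set.univ| ≤ δ * ν.real Set.univ := by
    have : (∫ z, F p z ∂ν) - F p x₀ * ν.real Set.univ = ∫ z, (F p z - F p x₀) ∂ν := by
      rw [integral_sub ((F p).integrable_of_compactSpace ν) (integrable_const _), integral_const,
        smul_eq_mul, mul_comm]
    rw [this, ← Real.norm_eq_abs]
    refine norm_integral_le_of_norm_le_const ?_
    filter_upwards [hν] with z hz
    exact hF z hz x₀ hx₀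
  calc |q p - ∫ z, F p z ∂ν|
      = |(q p - F p x₀ * ν.real Set.univ) -
          ((∫ z, F p z ∂ν) - F p x₀ * ν.real Set.univ)| := by congr 1; ring
    _ ≤ _ := abs_sub _ _
    _ ≤ _ := by linarith

theorem quadratureValues_eq_integral {ν : Measure X} [IsFiniteMeasure ν] {D : Set X}
    (hν : ∀ᵐ z ∂ν, z ∈ D) {φ : Fin r → C(X, ℝ)} {F : P → C(X, ℝ)} {q : P → ℝ}
    (hq : q ∈ quadratureValues d ν D φ F) {p : P} {f : C(X, ℝ)}
    (hf : f ∈ Submodule.span ℝ (Set.range φ)) (hFf : ∀ y ∈ D, F p y = f y) :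
    q p = ∫ z, F p z ∂ν := by
  obtain ⟨y, w, hy, hw, hw1, hφ, hqp⟩ := hq
  have h1 : ∫ z, F p z ∂ν = ∫ z, f z ∂ν := by
    refine integral_congr_ae ?_
    filter_upwards [hν] with z hz
    exact hFf z hz
  rw [← hqp, h1, Finset.sum_congr rfl fun i _ => by rw [hFf _ (hy i)]]
  clear h1 hFf
  induction hf using Submodule.span_induction with
  | mem f hf =>
    obtain ⟨j, rfl⟩ := hf
    exact hφ j
  | zero => simp
  | add f g _ _ hf hg =>
    simp only [ContinuousMap.add_apply, mul_add, Finset.sum_add_distrib]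
    rw [hf, hg, integral_add (f.integrable_of_compactSpace ν) (g.integrable_of_compactSpace ν)]
  | smul a f _ hf =>
    simp only [ContinuousMap.smul_apply, smul_eq_mul]
    rw [integral_const_mul, ← hf, Finset.mul_sum]
    exact Finset.sum_congr rfl fun i _ => by ring

theorem exists_discretization {κ : Type*} [Fintype κ] [Fintype P] {μ ν : Measure X}
    [IsFiniteMeasure μ] (hνμ : ν ≤ μ) {A D : κ → Set X} (hA : ∀ k, MeasurableSet (A k))
    (hdisj : Pairwise (Function.onFun Disjoint A)) (hU : ⋃ k, A k = Set.univ)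
    (hAD : ∀ k, A k ⊆ D k) (hD : ∀ k, IsCompact (D k)) (hDne : ∀ k, (D k).Nonempty)
    (φ : Fin r → C(X, ℝ)) (F : P → C(X, ℝ)) {δ τ η Λ : ℝ} (hδ : 0 < δ) (hτ : 0 < τ) (hη : 0 < η)
    (hΛ : 0 < Λ) (hF : ∀ p k, ∀ y ∈ D k, ∀ y' ∈ D k, |F p y - F p y'| ≤ δ) (bad : P → Finset κ)
    (hgood : ∀ p, ∀ k ∉ bad p, ∃ f ∈ Submodule.span ℝ (Set.range φ), ∀ y ∈ D k, F p y = f y)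
    (hbad : ∀ p, ∑ k ∈ bad p, μ.real (A k) ≤ τ) (n : κ → ℕ)
    (hn : ∀ k, μ.real (A k) ≤ n k * η) (hP : 2 * (Fintype.card P : ℝ) ≤ Real.exp Λ) :
    ∃ (y : (Σ k, Fin (n k)) × Fin (r + 1) → X) (w : (Σ k, Fin (n k)) × Fin (r + 1) → ℝ),
      0 ≤ w ∧ ∑ j, w j = ν.real Set.univ ∧
      ∀ p, |(∫ z, F p z ∂ν) - ∑ j, w j * F p (y j)| ≤
        Real.sqrt (2 * Λ) * (2 * δ * Real.sqrt (τ * η)) := by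
  classical
  have hνfin : IsFiniteMeasure ν := isFiniteMeasure_of_le μ hνμ
  -- The pieces are `n k` identical scaled copies of `ν` on `A k`; the cell itself is not
  -- subdivided. If `n k = 0` there are no copies, and the cell is null.
  let ν' : (Σ k, Fin (n k)) → Measure X := fun i =>
    ((n i.1 : NNReal)⁻¹) • ν.restrict (A i.1)
  have hν'D : ∀ i, ∀ᵐ z ∂ν' i, z ∈ D i.1 := fun i => by
    refine Measure.ae_smul_measure ?_ _
    filter_upwards [ae_restrict_mem (hA i.1)] with z hz
    exact hAD _ hz
  have hν'int : ∀ i (f : X → ℝ), ∫ z, f z ∂ν' i = (n i.1 : ℝ)⁻¹ * ∫ z in A i.1, f z ∂ν :=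
    fun i f => by
      simp only [ν']
      rw [integral_smul_nnreal_measure, NNReal.smul_def]
      simp
  have hν'mass : ∀ i, (ν' i).real Set.univ = (n i.1 : ℝ)⁻¹ * ν.real (A i.1) := fun i => by
    have := hν'int i fun _ => 1
    simpa using this
  have hn0 : ∀ k, n k = 0 → μ.real (A k) = 0 := fun k hk => by
    have := hn k
    rw [hk, Nat.cast_zero, zero_mul] at this
    exact le_antisymm this measureReal_nonneg
  have hνμA : ∀ k, ν.real (A k) ≤ μ.real (A k) := fun k =>
    ENNReal.toReal_mono (measure_ne_top _ _) (hνμ _)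
  have hsumint : ∀ f : C(X, ℝ), ∑ i, ∫ z, f z ∂ν' i = ∫ z, f z ∂ν := fun f => by
    rw [← setIntegral_univ, ← hU, integral_iUnion_fintype hA hdisj
      (fun k => (f.integrable_of_compactSpace ν).integrableOn), Fintype.sum_sigma]
    refine Finset.sum_congr rfl fun k _ => ?_
    simp only [hν'int, Finset.sum_const, Finset.card_univ, Fintype.card_fin, nsmul_eq_mul]
    rcases Nat.eq_zero_or_pos (n k) with h0 | h0
    · have hz : ν (A k) = 0 := by
        have h1 := (hνμA k).trans_eq (hn0 k h0)
        have h2 : ν.real (A k) = 0 := le_antisymm h1 measureReal_nonneg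
        exact (measureReal_eq_zero_iff).1 h2
      rw [h0, Measure.restrict_eq_zero.2 hz]
      simp
    · have : (n k : ℝ) ≠ 0 := by positivity
      field_simp
  have hm := fun i => integral_mem_convexHull_quadratureValues (ν' i) (hD i.1) (hDne i.1)
    (hν'D i) φ F
  let b : (Σ k, Fin (n k)) → P → ℝ := fun i p =>
    if i.1 ∈ bad p then 2 * δ * ((n i.1 : ℝ)⁻¹ * μ.real (A i.1)) else 0
  have hb : ∀ i, ∀ q ∈ quadratureValues (r + 1) (ν' i) (D i.1) φ F, ∀ p,
      |q p - ∫ z, F p z ∂ν' i| ≤ b i p := fun i q hq p => by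
    by_cases h : i.1 ∈ bad p
    · simp only [b, if_pos h]
      refine (abs_quadratureValues_sub_integral_le (hDne i.1) (hν'D i) hq (hF p i.1)).trans ?_
      rw [hν'mass]
      have := hνμA i.1
      gcongr
    · simp only [b, if_neg h]
      obtain ⟨f, hf, hFf⟩ := hgood p i.1 h
      rw [quadratureValues_eq_integral (hν'D i) hq hf hFf, sub_self, abs_zero]
  have hbB : ∀ p, ∑ i, b i p ^ 2 ≤ (2 * δ * Real.sqrt (τ * η)) ^ 2 := fun p => by
    calc ∑ i, b i p ^ 2
        = ∑ k, if k ∈ bad p then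
            (n k : ℝ) * (2 * δ * ((n k : ℝ)⁻¹ * μ.real (A k))) ^ 2 else 0 := by
          rw [Fintype.sum_sigma]
          refine Finset.sum_congr rfl fun k _ => ?_
          by_cases h : k ∈ bad p <;> simp [b, h]
      _ = ∑ k ∈ bad p, (n k : ℝ) * (2 * δ * ((n k : ℝ)⁻¹ * μ.real (A k))) ^ 2 := by
          simp
      -- One factor of the square is a piece's mass, at most `η`; the other sums to the mass of the
      -- cell.
      _ ≤ ∑ k ∈ bad p, 4 * δ ^ 2 * η * μ.real (A k) := by
          refine Finset.sum_le_sum fun k _ => ?_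
          rcases Nat.eq_zero_or_pos (n k) with h0 | h0
          · simp [h0, hn0 k h0]
          · have hpos : (0 : ℝ) < n k := by exact_mod_cast h0
            have e : (n k : ℝ) * (2 * δ * ((n k : ℝ)⁻¹ * μ.real (A k))) ^ 2 =
              4 * δ ^ 2 * ((n k : ℝ)⁻¹ * μ.real (A k)) * μ.real (A k) := by field_simp; ring
            rw [e]
            have h1 : (n k : ℝ)⁻¹ * μ.real (A k) ≤ η := by
              rw [inv_mul_le_iff₀ hpos]
              exact hn k
            have h2 : 0 ≤ μ.real (A k) := measureReal_nonneg
            gcongr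
      _ ≤ 4 * δ ^ 2 * η * τ := by
          rw [← Finset.mul_sum]
          exact mul_le_mul_of_nonneg_left (hbad p) (by positivity)
      _ = _ := by
          rw [mul_pow, Real.sq_sqrt (by positivity)]
          ring
  obtain ⟨q, hq, hle⟩ := exists_selection_abs_sum_le hm hb (by positivity) hΛ hbB hP
  choose y w hy hw hw1 hφ hqp using hq
  refine ⟨fun j => y j.1 j.2, fun j => w j.1 j.2, fun j => hw j.1 j.2, ?_, fun p => ?_⟩
  · rw [Fintype.sum_prod_type]
    simp only [hw1]
    have := hsumint 1
    simpa using this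
  · rw [Fintype.sum_prod_type]
    simp only [hqp]
    rw [← hsumint, abs_sub_comm, ← Finset.sum_sub_distrib]
    exact hle p

end Discretization

/-! ### Coverings from the lower bound on ball measures -/

/-- Around a maximal `t`-separated set the balls of radius `t / 2` are disjoint, each of mass at
least `M⁻¹`, while the closed balls of radius `t` cover `X`. -/
theorem exists_cover_small_diam {X : Type*} [MetricSpace X] [CompactSpace X] [Nonempty X]
    [MeasurableSpace X] [BorelSpace X] (hdist : ∀ x y : X, dist x y ≤ 4) {β c : ℝ} (hβ : 0 < β)
    (hc : 0 < c) (μ : Measure X) [IsProbabilityMeasure μ]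
    (hball : ∀ s : ℝ, 0 < s → s ≤ 1 → ∀ x : X,
      (8 / c) ^ β * s ^ β ≤ μ.real (Metric.ball x s)) {M : ℝ} (hM : 1 ≤ M) :
    ∃ (K : ℕ) (D : Fin K → Set X), (K : ℝ) ≤ M ∧ (∀ k, IsCompact (D k)) ∧
      (∀ k, (D k).Nonempty) ∧ ⋃ k, D k = Set.univ ∧
      ∀ k, ∀ y ∈ D k, ∀ y' ∈ D k, dist y y' ≤ c / 2 * M ^ (-1 / β) := by
  classical
  have hM0 : 0 < M := by linarith
  set u := M ^ (-1 / β) with hu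
  have hu0 : 0 < u := Real.rpow_pos_of_pos hM0 _
  have huβ : u ^ β = M⁻¹ := by
    rw [hu, ← Real.rpow_mul hM0.le, div_mul_cancel₀ _ hβ.ne', Real.rpow_neg_one]
  set t := c / 4 * u with ht
  have ht0 : 0 < t := by positivity
  -- For `t > 2` the ball hypothesis does not reach radius `t / 2`, but the allowed diameter `2 * t`
  -- exceeds `4`.
  rcases lt_or_ge 2 t with h2 | h2
  · refine ⟨1, fun _ => Set.univ, by simpa using hM, fun _ => isCompact_univ,
      fun _ => Set.univ_nonempty, Set.iUnion_const _, fun _ y _ y' _ => ?_⟩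
    have := hdist y y'
    linarith
  have hcard : ∀ C : Finset X, (C : Set X).Pairwise (fun x y => t ≤ dist x y) →
      (C.card : ℝ) ≤ M := fun C hC => by
    have hd : (C : Set X).PairwiseDisjoint fun x => Metric.ball x (t / 2) :=
      fun x hx y hy hxy => Metric.ball_disjoint_ball (by linarith [hC hx hy hxy])
    have h1 : μ.real (⋃ x ∈ C, Metric.ball x (t / 2)) =
        ∑ x ∈ C, μ.real (Metric.ball x (t / 2)) :=
      measureReal_biUnion_finset hd fun _ _ => measurableSet_ball
    have h3 : ∀ x ∈ C, M⁻¹ ≤ μ.real (Metric.ball x (t / 2)) := fun x _ => by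
      refine le_trans (le_of_eq ?_) (hball (t / 2) (by linarith) (by linarith) x)
      rw [← Real.mul_rpow (by positivity) (by positivity), ← huβ]
      congr 1
      rw [ht]
      field_simp
      norm_num
    have h4 := Finset.sum_le_sum h3
    rw [← h1, Finset.sum_const, nsmul_eq_mul] at h4
    have h5 := h4.trans measureReal_le_one
    rwa [← div_eq_mul_inv, div_le_one hM0] at h5
  let Q : ℕ → Prop := fun n => ∃ C : Finset X,
    (C : Set X).Pairwise (fun x y => t ≤ dist x y) ∧ C.card = n
  have hQ0 : Q 0 := ⟨∅, by simp, rfl⟩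
  have hbd : ∀ n, Q n → n ≤ ⌊M⌋₊ := by
    rintro n ⟨C, hC, rfl⟩
    exact Nat.le_floor (hcard C hC)
  obtain ⟨C, hC, hCn⟩ := Nat.findGreatest_spec (P := Q) (Nat.zero_le ⌊M⌋₊) hQ0
  have hcov : ∀ x : X, ∃ z ∈ C, dist x z ≤ t := fun x => by
    by_contra! h
    have hx : x ∉ C := fun hx => by
      have := h x hx
      rw [dist_self] at this
      linarith
    have hQ : Q (C.card + 1) := by
      refine ⟨insert x C, ?_, Finset.card_insert_of_notMem hx⟩
      rw [Finset.coe_insert]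
      refine hC.insert fun z hz _ => ⟨(h z hz).le, ?_⟩
      rw [dist_comm]
      exact (h z hz).le
    have := Nat.le_findGreatest (hbd _ hQ) hQ
    omega
  refine ⟨C.card, fun k => Metric.closedBall (C.equivFin.symm k : X) t, hcard C hC,
    fun k => Metric.isClosed_closedBall.isCompact,
    fun k => ⟨_, Metric.mem_closedBall_self ht0.le⟩, ?_, fun k y hy y' hy' => ?_⟩
  · refine Set.eq_univ_of_forall fun x => ?_
    obtain ⟨z, hz, hxz⟩ := hcov x
    refine Set.mem_iUnion.2 ⟨C.equivFin ⟨z, hz⟩, ?_⟩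
    simpa using hxz
  · rw [Metric.mem_closedBall] at hy hy'
    have := dist_triangle_right y y' (C.equivFin.symm k : X)
    rw [ht] at hy hy'
    linarith

/-! ### Cells crossing a sphere of radius `t j` -/

section Annuli

variable {l : ℕ} {t : Fin (l + 1) → ℝ}

theorem IsPartitionZeroPi.exists_mem_Icc (ht : IsPartitionZeroPi t) {s : ℝ} (h0 : 0 ≤ s)
    (hs : s ≤ Real.pi) : ∃ j : Fin l, t j.castSucc ≤ s ∧ s ≤ t j.succ := by
  by_contra! h
  have hle : ∀ i, t i ≤ s := fun i => by
    induction i using Fin.induction with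
    | zero => rw [ht.zero]; exact h0
    | succ i ih => exact (h i ih).le
  obtain _ | l := l
  · have h1 := ht.zero
    have h2 := ht.last
    rw [show Fin.last 0 = 0 from rfl, h1] at h2
    exact Real.pi_pos.ne h2
  · have h1 := h (Fin.last l) (hle _)
    rw [Fin.succ_last, ht.last] at h1
    linarith

/-- A set with points on both sides of a sphere lies within its diameter of that sphere. The radii
`0` and `π` cannot be crossed, as distances lie between them. -/
theorem IsPartitionZeroPi.subset_metricAnnulus {X : Type*} [MetricSpace X]
    (ht : IsPartitionZeroPi t) (hdist : ∀ x y : X, dist x y ≤ Real.pi) (x : X) {D : Set X}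
    (hDne : D.Nonempty) {δ : ℝ} (hD : ∀ y ∈ D, ∀ y' ∈ D, dist y y' ≤ δ)
    (hcross : ∀ j : Fin (l + 1), 0 < j → j < Fin.last l →
      ¬ D ⊆ metricAnnulus x (t j - δ) (t j + δ)) :
    ∃ j : Fin l, D ⊆ metricAnnulus x (t j.castSucc) (t j.succ) := by
  obtain ⟨y₀, hy₀⟩ := hDne
  have hsub : ∀ j, (∃ y ∈ D, dist x y ≤ t j) → (∃ y ∈ D, t j ≤ dist x y) →
      D ⊆ metricAnnulus x (t j - δ) (t j + δ) := by
    rintro j ⟨y, hy, hyt⟩ ⟨y', hy', hyt'⟩ z hz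
    have h1 := dist_triangle x y z
    have h2 := dist_triangle x z y'
    have h3 := hD y hy z hz
    have h4 := hD z hz y' hy'
    constructor <;> linarith
  obtain ⟨j, hj1, hj2⟩ := ht.exists_mem_Icc dist_nonneg (hdist x y₀)
  refine ⟨j, fun y hy => ⟨?_, ?_⟩⟩
  · by_contra! h
    refine hcross j.castSucc (Fin.pos_iff_ne_zero.2 fun h0 => ?_) j.castSucc_lt_last
      (hsub _ ⟨y, hy, h.le⟩ ⟨y₀, hy₀, hj1⟩)
    rw [h0, ht.zero] at h
    exact h.not_ge dist_nonneg
  · by_contra! h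
    refine hcross j.succ j.succ_pos (lt_of_le_of_ne (Fin.le_last _) fun h0 => ?_)
      (hsub _ ⟨y₀, hy₀, hj2⟩ ⟨y, hy, h.le⟩)
    rw [h0, ht.last] at h
    exact h.not_ge (hdist x y)

theorem sum_measure_crossing_le {X κ : Type*} [MetricSpace X] [MeasurableSpace X] [Fintype κ]
    (μ : Measure X) [IsProbabilityMeasure μ] {c₂ δ : ℝ} (hc₂ : 1 < c₂) (hδ : 0 < δ)
    (hannulus : ∀ x : X, ∀ δ ∈ Set.Ioo (0 : ℝ) Real.pi, ∀ j : Fin (l + 1),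
      0 < j → j < Fin.last l →
        μ.real (metricAnnulus x (t j - δ) (t j + δ)) ≤ c₂ * δ)
    (x : X) {A : κ → Set X} (hA : ∀ k, MeasurableSet (A k))
    (hdisj : Pairwise (Function.onFun Disjoint A)) (bad : Finset κ)
    (hbad : ∀ k ∈ bad, ∃ j : Fin (l + 1), 0 < j ∧ j < Fin.last l ∧
      A k ⊆ metricAnnulus x (t j - δ) (t j + δ)) :
    ∑ k ∈ bad, μ.real (A k) ≤ l * (c₂ * δ) := by
  classical
  let I : Finset (Fin (l + 1)) := Finset.univ.filter fun j => 0 < j ∧ j < Fin.last l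
  have hI : I.card ≤ l := by
    have : I ⊆ Finset.univ.erase 0 := fun j hj => by
      simp only [I, Finset.mem_filter, Finset.mem_univ, true_and] at hj
      simp [hj.1.ne']
    simpa using Finset.card_le_card this
  have hann : ∀ j ∈ I, μ.real (metricAnnulus x (t j - δ) (t j + δ)) ≤ c₂ * δ := fun j hj => by
    simp only [I, Finset.mem_filter, Finset.mem_univ, true_and] at hj
    rcases lt_or_ge δ Real.pi with h | h
    -- For `δ ≥ π` the bound is trivial, since then `c₂ * δ > 1`.
    · exact hannulus x δ ⟨hδ, h⟩ j hj.1 hj.2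
    · refine measureReal_le_one.trans ?_
      nlinarith [Real.pi_gt_three]
  calc ∑ k ∈ bad, μ.real (A k) = μ.real (⋃ k ∈ bad, A k) :=
        (measureReal_biUnion_finset (fun i _ j _ h => hdisj h) fun k _ => hA k).symm
    _ ≤ μ.real (⋃ j ∈ I, metricAnnulus x (t j - δ) (t j + δ)) := by
        refine measureReal_mono (Set.iUnion₂_subset fun k hk => ?_) (measure_ne_top _ _)
        obtain ⟨j, h0, h1, hj⟩ := hbad k hk
        exact hj.trans (Set.subset_biUnion_of_mem
          (u := fun j => metricAnnulus x (t j - δ) (t j + δ)) (by simp [I, h0, h1]))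
    _ ≤ ∑ j ∈ I, μ.real (metricAnnulus x (t j - δ) (t j + δ)) :=
        measureReal_biUnion_finset_le _ _
    _ ≤ ∑ _j ∈ I, c₂ * δ := Finset.sum_le_sum hann
    _ = I.card * (c₂ * δ) := by rw [Finset.sum_const, nsmul_eq_mul]
    _ ≤ l * (c₂ * δ) := by
        have : (I.card : ℝ) ≤ l := by exact_mod_cast hI
        have h2 : 0 ≤ c₂ * δ := by nlinarith
        gcongr

end Annuli

/-! ### The kernel, reindexing, and numerical constants -/

/-- The continuous function `Φ(ρ(x, ·))`. -/
def zonalFunction {X : Type*} [MetricSpace X] (hdist : ∀ x y : X, dist x y ≤ Real.pi) {Φ : ℝ → ℝ}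
    (hΦ : ContinuousOn Φ (Set.Icc 0 Real.pi)) (x : X) : C(X, ℝ) where
  toFun z := Φ (dist x z)
  continuous_toFun := hΦ.comp_continuous (by fun_prop) fun z => ⟨dist_nonneg, hdist x z⟩

theorem exists_fin_reindex {J X : Type*} [Fintype J] [Nonempty X] {M : ℕ}
    (hJ : Fintype.card J ≤ M) (y : J → X) (w : J → ℝ) :
    ∃ (y' : Fin M → X) (w' : Fin M → ℝ), ∀ f : X → ℝ,
      ∑ i, w' i * f (y' i) = ∑ j, w j * f (y j) := by
  classical
  obtain ⟨e⟩ : Nonempty (J ↪ Fin M) :=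
    Function.Embedding.nonempty_of_card_le (by rwa [Fintype.card_fin])
  exact ⟨_, _, fun f => sum_extend_smul_extend e w y (Classical.arbitrary X) f⟩

/-- The factor `2` is absorbed by `N ^ (1/4)`, and `1/4 + β/2 + 3/2 ≤ 9/4 * β` because `β ≥ 1`. -/
theorem two_mul_le_exp_of_card {β : ℝ} (hβ : 1 ≤ β) {N K : ℕ} (hN : 20 ≤ N)
    (hK : (K : ℝ) ≤ (N : ℝ) ^ (β / 2 + 3 / 2)) :
    2 * (K : ℝ) ≤ Real.exp (9 / 4 * β * Real.log N) := by
  have hN' : (20 : ℝ) ≤ N := by exact_mod_cast hN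
  have hN0 : (0 : ℝ) < N := by linarith
  have h2 : (2 : ℝ) ≤ (N : ℝ) ^ (1 / 4 : ℝ) := by
    calc (2 : ℝ) = (16 : ℝ) ^ (1 / 4 : ℝ) := by
          rw [show (16 : ℝ) = 2 ^ (4 : ℝ) by norm_num, ← Real.rpow_mul (by norm_num)]
          norm_num
      _ ≤ _ := Real.rpow_le_rpow (by norm_num) (by linarith) (by norm_num)
  calc 2 * (K : ℝ) ≤ (N : ℝ) ^ (1 / 4 : ℝ) * (N : ℝ) ^ (β / 2 + 3 / 2) := by gcongr
    _ = (N : ℝ) ^ (1 / 4 + (β / 2 + 3 / 2)) := (Real.rpow_add hN0 _ _).symm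
    _ ≤ (N : ℝ) ^ (9 / 4 * β) :=
        Real.rpow_le_rpow_of_exponent_le (by linarith) (by linarith)
    _ = _ := by rw [Real.rpow_def_of_pos hN0, mul_comm]

/-- The Hoeffding term contributes `6`, its square carrying `9/2 * 4 * 2 = 36`; the net contributes
`1`. -/
theorem discretization_error_le {β c₁ c₂ l : ℝ} (hβ : 1 ≤ β) (hc₁ : 1 < c₁) (hc₂ : 1 < c₂)
    (hl : 1 ≤ l) {N : ℕ} (hN : 20 ≤ N) {δ : ℝ} (hδ : δ = c₁ * (N : ℝ) ^ (-1 / β)) :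
    Real.sqrt (2 * (9 / 4 * β * Real.log N)) * (2 * δ * Real.sqrt (l * (c₂ * δ) * (2 / N))) +
        c₁ * (N : ℝ) ^ (-(1 / 2 : ℝ) - 3 / (2 * β)) ≤
      7 * (c₁ ^ 2 * Real.sqrt (c₂ * l) * Real.sqrt β) *
        (N : ℝ) ^ (-(1 / 2 : ℝ) - 3 / (2 * β)) * Real.sqrt (Real.log N) := by
  have hN' : (20 : ℝ) ≤ N := by exact_mod_cast hN
  have hN0 : (0 : ℝ) < N := by linarith
  have hL : 1 ≤ Real.log N := by
    rw [Real.le_log_iff_exp_le hN0]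
    linarith [Real.exp_one_lt_d9]
  set W := (N : ℝ) ^ (-(1 / 2 : ℝ) - 3 / (2 * β)) with hW
  set u := (N : ℝ) ^ (-1 / β) with hu
  have hu0 : 0 < u := Real.rpow_pos_of_pos hN0 _
  have hW0 : 0 < W := Real.rpow_pos_of_pos hN0 _
  have hWu : W ^ 2 = u ^ 3 / N := by
    rw [hW, hu, ← Real.rpow_natCast, ← Real.rpow_natCast, ← Real.rpow_mul hN0.le,
      ← Real.rpow_mul hN0.le, ← Real.rpow_sub_one hN0.ne']
    congr 1
    push_cast
    field_simp
    ring
  have hs1 : 1 ≤ Real.sqrt (c₂ * l) := Real.one_le_sqrt.2 (by nlinarith)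
  have hs2 : 1 ≤ Real.sqrt β := Real.one_le_sqrt.2 hβ
  have hs3 : 1 ≤ Real.sqrt (Real.log N) := Real.one_le_sqrt.2 hL
  have e1 : Real.sqrt (c₂ * l) ^ 2 = c₂ * l := Real.sq_sqrt (by nlinarith)
  have e2 : Real.sqrt β ^ 2 = β := Real.sq_sqrt (by linarith)
  have e3 : Real.sqrt (Real.log N) ^ 2 = Real.log N := Real.sq_sqrt (by linarith)
  have hδ0 : 0 < δ := by rw [hδ]; positivity
  have h1 : Real.sqrt (2 * (9 / 4 * β * Real.log N)) *
      (2 * δ * Real.sqrt (l * (c₂ * δ) * (2 / N))) ≤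
      6 * (c₁ ^ 2 * Real.sqrt (c₂ * l) * Real.sqrt β) * W * Real.sqrt (Real.log N) := by
    refine abs_le_of_sq_le_sq' ?_ (by positivity) |>.2
    have e4 : (Real.sqrt (2 * (9 / 4 * β * Real.log N)) *
        (2 * δ * Real.sqrt (l * (c₂ * δ) * (2 / N)))) ^ 2 =
        36 * (c₁ ^ 3 * (c₂ * l) * β) * (u ^ 3 / N) * Real.log N := by
      rw [mul_pow, mul_pow, Real.sq_sqrt (by positivity), Real.sq_sqrt (by positivity), hδ]
      field_simp
      ring
    have e5 : (6 * (c₁ ^ 2 * Real.sqrt (c₂ * l) * Real.sqrt β) * W *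
        Real.sqrt (Real.log N)) ^ 2 =
        36 * (c₁ ^ 4 * (c₂ * l) * β) * (u ^ 3 / N) * Real.log N := by
      calc _ = 36 * (c₁ ^ 4 * Real.sqrt (c₂ * l) ^ 2 * Real.sqrt β ^ 2) * W ^ 2 *
            Real.sqrt (Real.log N) ^ 2 := by ring
        _ = _ := by rw [e1, e2, e3, hWu]
    rw [e4, e5]
    have : c₁ ^ 3 ≤ c₁ ^ 4 := pow_le_pow_right₀ hc₁.le (by norm_num)
    gcongr
  have h2 : c₁ * W ≤ (c₁ ^ 2 * Real.sqrt (c₂ * l) * Real.sqrt β) * W *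
      Real.sqrt (Real.log N) := by
    calc c₁ * W = (c₁ * 1 * 1) * W * 1 := by ring
      _ ≤ _ := by
        have : c₁ ≤ c₁ ^ 2 := by nlinarith
        gcongr
  linarith

/-! ### Assembling the estimate -/

theorem exists_nodes_of_measure_le {X : Type*} [MetricSpace X] [CompactSpace X] [Nonempty X]
    [MeasurableSpace X] [BorelSpace X] (hdist : ∀ x y : X, dist x y ≤ Real.pi)
    {r l : ℕ} {t : Fin (l + 1) → ℝ} (ht : IsPartitionZeroPi t) {Φ : ℝ → ℝ}
    (hΦlip : ∀ s ∈ Set.Icc (0 : ℝ) Real.pi, ∀ s' ∈ Set.Icc (0 : ℝ) Real.pi,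
      |Φ s - Φ s'| ≤ |s - s'|)
    (hΦ : MemClassS X r t Φ) {β c₁ c₂ : ℝ} (hβ : 1 ≤ β) (hc₁ : 1 < c₁) (hc₂ : 1 < c₂)
    (μ : Measure X) [IsProbabilityMeasure μ]
    (hball : ∀ s : ℝ, 0 < s → s ≤ 1 → ∀ x : X,
      (8 / c₁) ^ β * s ^ β ≤ μ.real (Metric.ball x s))
    (hannulus : ∀ x : X, ∀ δ ∈ Set.Ioo (0 : ℝ) Real.pi, ∀ j : Fin (l + 1),
      0 < j → j < Fin.last l →
        μ.real (metricAnnulus x (t j - δ) (t j + δ)) ≤ c₂ * δ)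
    {ν : Measure X} (hνμ : ν ≤ μ) {N : ℕ} (hN : 20 ≤ N) :
    ∃ (y : Fin ((r + 2) * N) → X) (w : Fin ((r + 2) * N) → ℝ), ∀ x : X,
      |(∫ z, Φ (dist x z) ∂ν) - ∑ j, w j * Φ (dist x (y j))| ≤
        7 * (c₁ ^ 2 * Real.sqrt (c₂ * l) * Real.sqrt β) *
          (N : ℝ) ^ (-(1 / 2 : ℝ) - 3 / (2 * β)) * Real.sqrt (Real.log N) := by
  classical
  have hN' : (20 : ℝ) ≤ N := by exact_mod_cast hN
  have hN0 : (0 : ℝ) < N := by linarith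
  have hβ0 : 0 < β := by linarith
  have hνfin : IsFiniteMeasure ν := isFiniteMeasure_of_le μ hνμ
  have hνuniv : ν.real Set.univ ≤ 1 := by
    have := ENNReal.toReal_mono (measure_ne_top μ _) (hνμ Set.univ)
    exact this.trans measureReal_le_one
  have hl : 1 ≤ l := by
    obtain ⟨j, -⟩ := ht.exists_mem_Icc le_rfl Real.pi_pos.le
    have := j.2
    omega
  have hl' : (1 : ℝ) ≤ l := by exact_mod_cast hl
  have hdist4 : ∀ x y : X, dist x y ≤ 4 := fun x y => (hdist x y).trans Real.pi_le_four
  obtain ⟨hΦc, V, hVfin, hVr, hV⟩ := hΦ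
  set F := zonalFunction hdist hΦc with hFdef
  have hFapp : ∀ x z, F x z = Φ (dist x z) := fun _ _ => rfl
  have hFx : ∀ x x' z, |F x z - F x' z| ≤ dist x x' := fun x x' z =>
    (hΦlip _ ⟨dist_nonneg, hdist _ _⟩ _ ⟨dist_nonneg, hdist _ _⟩).trans
      (abs_dist_sub_le x x' z)
  have hFz : ∀ x z z', |F x z - F x z'| ≤ dist z z' := fun x z z' => by
    have := hFx z z' x
    simpa only [hFapp, dist_comm] using this
  -- The first covering, with `M = N / 2`, supplies the cells. The second supplies the net of
  -- centres: its exponent turns `M ^ (-1 / β)` into the target rate.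
  obtain ⟨K, D, hKM, hDc, hDne, hDU, hDdiam⟩ := exists_cover_small_diam hdist4 hβ0
    (by linarith) μ hball (M := N / 2) (by linarith)
  obtain ⟨K', D', hKM', -, hDne', hDU', hDdiam'⟩ := exists_cover_small_diam hdist4 hβ0
    (by linarith) μ hball (M := (N : ℝ) ^ (β / 2 + 3 / 2))
    (Real.one_le_rpow (by linarith) (by linarith))
  choose a ha using hDne'
  set δ := c₁ * (N : ℝ) ^ (-1 / β) with hδ
  have hδ0 : 0 < δ := mul_pos (by linarith) (Real.rpow_pos_of_pos hN0 _)
  have hDδ : ∀ k, ∀ y ∈ D k, ∀ y' ∈ D k, dist y y' ≤ δ := fun k y hy y' hy' => by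
    refine (hDdiam k y hy y' hy').trans ?_
    have h1 : ((N : ℝ) / 2) ^ (-1 / β) ≤ 2 * (N : ℝ) ^ (-1 / β) := by
      rw [Real.div_rpow hN0.le (by norm_num), div_eq_mul_inv, mul_comm,
        ← Real.rpow_neg (by norm_num)]
      refine mul_le_mul_of_nonneg_right ?_ (Real.rpow_pos_of_pos hN0 _).le
      calc (2 : ℝ) ^ (-(-1 / β)) ≤ 2 ^ (1 : ℝ) := by
            refine Real.rpow_le_rpow_of_exponent_le (by norm_num) ?_
            rw [neg_div, neg_neg, div_le_one hβ0]
            exact hβ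
        _ = 2 := Real.rpow_one 2
    rw [hδ]
    nlinarith
  set A := disjointed D with hAdef
  have hAmeas : ∀ k, MeasurableSet (A k) := fun k =>
    disjointedRec (fun _ i h => h.diff (hDc i).measurableSet) (hDc k).measurableSet
  have hAdisj : Pairwise (Function.onFun Disjoint A) := disjoint_disjointed D
  have hAU : ⋃ k, A k = Set.univ := iUnion_disjointed.trans hDU
  have hAD : ∀ k, A k ⊆ D k := fun k => disjointed_subset D k
  let n : Fin K → ℕ := fun k => ⌈(N : ℝ) / 2 * μ.real (A k)⌉₊
  have hn : ∀ k, μ.real (A k) ≤ n k * (2 / N) := fun k => by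
    have := Nat.le_ceil ((N : ℝ) / 2 * μ.real (A k))
    calc μ.real (A k) = (N : ℝ) / 2 * μ.real (A k) * (2 / N) := by field_simp
      _ ≤ _ := by
        refine mul_le_mul_of_nonneg_right this (by positivity)
  -- Half of the budget `N` pays for the total mass, the other half for rounding up in each of the
  -- `K ≤ N / 2` cells.
  have hnsum : ∑ k, n k ≤ N := by
    have h1 : ∑ k, μ.real (A k) = 1 := by
      rw [← measureReal_iUnion_fintype hAdisj hAmeas, hAU, probReal_univ]
    have h2 : (∑ k, n k : ℝ) ≤ ∑ k, ((N : ℝ) / 2 * μ.real (A k) + 1) :=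
      Finset.sum_le_sum fun k _ => (Nat.ceil_lt_add_one
        (mul_nonneg (by positivity) measureReal_nonneg)).le
    rw [Finset.sum_add_distrib, ← Finset.mul_sum, h1] at h2
    simp only [mul_one, Finset.sum_const, Finset.card_univ, Fintype.card_fin, nsmul_eq_mul] at h2
    have h3 : (∑ k, n k : ℝ) ≤ N := by linarith
    exact_mod_cast h3
  let b := Module.finBasisOfFinrankEq ℝ V hVr
  let bad : Fin K' → Finset (Fin K) := fun p => Finset.univ.filter fun k =>
    ∃ j : Fin (l + 1), 0 < j ∧ j < Fin.last l ∧
      D k ⊆ metricAnnulus (a p) (t j - δ) (t j + δ)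
  have hgood : ∀ p, ∀ k ∉ bad p, ∃ f ∈ Submodule.span ℝ (Set.range fun j => (b j : C(X, ℝ))),
      ∀ y ∈ D k, F (a p) y = f y := fun p k hk => by
    simp only [bad, Finset.mem_filter, Finset.mem_univ, true_and, not_exists, not_and] at hk
    obtain ⟨j, hj⟩ := ht.subset_metricAnnulus hdist (a p) (hDne k) (hDδ k) hk
    obtain ⟨f, hf, hfe⟩ := hV (a p) j
    refine ⟨f, ?_, fun y hy => hfe y (hj hy)⟩
    have hspan : Submodule.span ℝ (Set.range fun j => (b j : C(X, ℝ))) = V := by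
      have := congrArg (Submodule.map V.subtype) b.span_eq
      rw [Submodule.map_span, Submodule.map_top, Submodule.range_subtype, ← Set.range_comp] at this
      exact this
    rwa [hspan]
  obtain ⟨y, w, hw0, hw1, hle⟩ := exists_discretization hνμ hAmeas hAdisj hAU hAD hDc hDne
    (fun j => (b j : C(X, ℝ))) (fun p => F (a p)) (δ := δ) (τ := l * (c₂ * δ)) (η := 2 / N)
    (Λ := 9 / 4 * β * Real.log N) hδ0 (by positivity) (by positivity)
    (mul_pos (by positivity) (Real.log_pos (by linarith)))
    (fun p k z hz z' hz' => (hFz _ z z').trans (hDδ k z hz z' hz')) bad hgood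
    (fun p => sum_measure_crossing_le μ hc₂ hδ0 hannulus (a p) hAmeas hAdisj (bad p)
      fun k hk => by
        simp only [bad, Finset.mem_filter, Finset.mem_univ, true_and] at hk
        obtain ⟨j, h0, h1, hj⟩ := hk
        exact ⟨j, h0, h1, (hAD k).trans hj⟩)
    n hn (by rw [Fintype.card_fin]; exact two_mul_le_exp_of_card hβ hN hKM')
  have hcard : Fintype.card ((Σ k, Fin (n k)) × Fin (r + 1)) ≤ (r + 2) * N := by
    simp only [Fintype.card_prod, Fintype.card_sigma, Fintype.card_fin]
    calc (∑ k, n k) * (r + 1) ≤ N * (r + 2) := Nat.mul_le_mul hnsum (by omega)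
      _ = _ := mul_comm _ _
  obtain ⟨y', w', hyw⟩ := exists_fin_reindex hcard y w
  refine ⟨y', w', fun x => ?_⟩
  rw [hyw fun z => Φ (dist x z)]
  obtain ⟨p, hp⟩ := Set.mem_iUnion.1 (hDU'.ge (Set.mem_univ x))
  have hxp : dist x (a p) ≤ c₁ / 2 * (N : ℝ) ^ (-(1 / 2 : ℝ) - 3 / (2 * β)) := by
    have := hDdiam' p x hp _ (ha p)
    rw [← Real.rpow_mul hN0.le] at this
    convert this using 3
    field_simp
    ring
  refine le_trans ?_ (discretization_error_le hβ hc₁ hc₂ hl' hN hδ)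
  have h1 : |(∫ z, F x z ∂ν) - ∫ z, F (a p) z ∂ν| ≤ dist x (a p) := by
    rw [← integral_sub ((F x).integrable_of_compactSpace ν)
      ((F (a p)).integrable_of_compactSpace ν), ← Real.norm_eq_abs]
    refine (norm_integral_le_of_norm_le_const (C := dist x (a p))
      (Filter.Eventually.of_forall fun z => hFx x (a p) z)).trans ?_
    exact mul_le_of_le_one_right dist_nonneg hνuniv
  -- Nonnegative weights of total at most `1` make the discrete sum `1`-Lipschitz in `x`, like the
  -- integral.
  have h2 : |∑ j, w j * F (a p) (y j) - ∑ j, w j * F x (y j)| ≤ dist x (a p) := by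
    rw [← Finset.sum_sub_distrib]
    calc _ ≤ ∑ j, |w j * F (a p) (y j) - w j * F x (y j)| := Finset.abs_sum_le_sum_abs _ _
      _ ≤ ∑ j, w j * dist x (a p) := by
          refine Finset.sum_le_sum fun j _ => ?_
          rw [← mul_sub, abs_mul, abs_of_nonneg (hw0 j), dist_comm]
          exact mul_le_mul_of_nonneg_left (hFx _ _ _) (hw0 j)
      _ = ν.real Set.univ * dist x (a p) := by rw [← Finset.sum_mul, hw1]
      _ ≤ _ := mul_le_of_le_one_left dist_nonneg hνuniv
  have h3 := hle p
  calc |(∫ z, Φ (dist x z) ∂ν) - ∑ j, w j * Φ (dist x (y j))|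
      = |((∫ z, F x z ∂ν) - ∫ z, F (a p) z ∂ν) +
          ((∫ z, F (a p) z ∂ν) - ∑ j, w j * F (a p) (y j)) +
          (∑ j, w j * F (a p) (y j) - ∑ j, w j * F x (y j))| := by
        simp only [hFapp]
        congr 1
        ring
    _ ≤ _ := abs_add_three _ _ _
    _ ≤ _ := by linarith

theorem mainTheorem2 {X : Type*} [MetricSpace X] [CompactSpace X] [PathConnectedSpace X]
    [MeasurableSpace X] [BorelSpace X]
    (hdiam : Metric.diam (Set.univ : Set X) = Real.pi)
    (r l : ℕ) (t : Fin (l + 1) → ℝ) (ht : IsPartitionZeroPi t)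
    (Φ : ℝ → ℝ)
    (hΦlip : ∀ s ∈ Set.Icc (0 : ℝ) Real.pi, ∀ s' ∈ Set.Icc (0 : ℝ) Real.pi,
      |Φ s - Φ s'| ≤ |s - s'|)
    (hΦ : MemClassS X r t Φ)
    (β c₁ c₂ : ℝ) (hβ : 1 ≤ β) (hc₁ : 1 < c₁) (hc₂ : 1 < c₂)
    (μ : MeasureTheory.Measure X) [MeasureTheory.IsProbabilityMeasure μ]
    [MeasureTheory.NullSingletonClass μ]
    (hball : ∀ s : ℝ, 0 < s → s ≤ 1 → ∀ x : X,
      (8 / c₁) ^ β * s ^ β ≤ μ.real (Metric.ball x s))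
    (hannulus : ∀ x : X, ∀ δ ∈ Set.Ioo (0 : ℝ) Real.pi, ∀ j : Fin (l + 1),
      0 < j → j < Fin.last l →
        μ.real (metricAnnulus x (t j - δ) (t j + δ)) ≤ c₂ * δ)
    (g : X → ℝ) (hg : MeasureTheory.MemLp g ⊤ μ) (hg1 : MeasureTheory.eLpNorm g ⊤ μ ≤ 1)
    (N : ℕ) (hN : 20 ≤ N) :
    ∃ (y : Fin (2 * (r + 2) * N) → X) (w : Fin (2 * (r + 2) * N) → ℝ), ∀ x : X,
      |(∫ z, Φ (dist x z) * g z ∂μ) - ∑ j, w j * Φ (dist x (y j))| ≤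
        45 * (8 * c₁ ^ 2 * Real.sqrt (c₂ * (l : ℝ)) * Real.sqrt β) *
          (N : ℝ) ^ (-(1 / 2 : ℝ) - 3 / (2 * β)) * Real.sqrt (Real.log (N : ℝ)) := by
  have hdist : ∀ x y : X, dist x y ≤ Real.pi := fun x y => by
    rw [← hdiam]
    exact Metric.dist_le_diam_of_mem isCompact_univ.isBounded trivial trivial
  have hg1' : ∀ᵐ z ∂μ, |g z| ≤ 1 := by
    filter_upwards [enorm_ae_le_eLpNormEssSup g μ] with z hz
    rw [← eLpNorm_exponent_top] at hz
    have := hz.trans hg1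
    rw [← ofReal_norm, ENNReal.ofReal_le_one] at this
    exact this
  have hgm : AEMeasurable g μ := hg.aestronglyMeasurable.aemeasurable
  have hle : ∀ h : X → ℝ, (∀ᵐ z ∂μ, h z ≤ 1) →
      μ.withDensity (fun z => ENNReal.ofReal (h z)) ≤ μ := fun h hh => by
    refine (withDensity_mono (g := 1) ?_).trans_eq withDensity_one
    filter_upwards [hh] with z hz
    exact ENNReal.ofReal_le_one.2 hz
  -- `ENNReal.ofReal` truncates at zero, so the densities `g` and `-g` give the positive and
  -- negative parts.
  obtain ⟨y₁, w₁, h₁⟩ := exists_nodes_of_measure_le hdist ht hΦlip hΦ hβ hc₁ hc₂ μ hball hannulus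
    (hle g (hg1'.mono fun z hz => (le_abs_self _).trans hz)) hN
  obtain ⟨y₂, w₂, h₂⟩ := exists_nodes_of_measure_le hdist ht hΦlip hΦ hβ hc₁ hc₂ μ hball hannulus
    (hle (fun z => -g z) (hg1'.mono fun z hz => (neg_le_abs _).trans hz)) hN
  obtain ⟨y, w, hyw⟩ := exists_fin_reindex
    (J := Fin ((r + 2) * N) ⊕ Fin ((r + 2) * N)) (M := 2 * (r + 2) * N)
    (by simp only [Fintype.card_sum, Fintype.card_fin]; linarith)
    (Sum.elim y₁ y₂) (Sum.elim w₁ fun j => -w₂ j)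
  refine ⟨y, w, fun x => ?_⟩
  rw [hyw fun z => Φ (dist x z), Fintype.sum_sum_type]
  simp only [Sum.elim_inl, Sum.elim_inr, neg_mul, Finset.sum_neg_distrib]
  have hwd : ∀ h : X → ℝ, AEMeasurable h μ →
      ∫ z, Φ (dist x z) ∂μ.withDensity (fun z => ENNReal.ofReal (h z)) =
        ∫ z, max (h z) 0 * Φ (dist x z) ∂μ := fun h hh => by
    rw [integral_withDensity_eq_integral_toReal_smul₀ hh.ennreal_ofReal
      (Filter.Eventually.of_forall fun _ => ENNReal.ofReal_lt_top)]
    simp only [ENNReal.toReal_ofReal', smul_eq_mul]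
  have hint : ∀ h : X → ℝ, AEMeasurable h μ → (∀ᵐ z ∂μ, |h z| ≤ 1) →
      Integrable (fun z => max (h z) 0 * Φ (dist x z)) μ := fun h hh hb => by
    refine ((zonalFunction hdist hΦ.1 x).integrable_of_compactSpace μ).bdd_mul (c := 1)
      (hh.max aemeasurable_const).aestronglyMeasurable ?_
    filter_upwards [hb] with z hz
    rw [Real.norm_eq_abs, abs_of_nonneg (le_max_right _ _)]
    exact max_le ((le_abs_self _).trans hz) zero_le_one
  have hsplit : ∫ z, Φ (dist x z) * g z ∂μ =
      (∫ z, Φ (dist x z) ∂μ.withDensity (fun z => ENNReal.ofReal (g z))) -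
        ∫ z, Φ (dist x z) ∂μ.withDensity (fun z => ENNReal.ofReal (-g z)) := by
    rw [hwd g hgm, hwd (fun z => -g z) hgm.neg, ← integral_sub (hint g hgm hg1')
      (hint (fun z => -g z) hgm.neg (by simpa only [abs_neg] using hg1'))]
    congr 1
    ext z
    rw [← sub_mul, max_zero_sub_max_neg_zero_eq_self, mul_comm]
  rw [hsplit]
  have e₁ := abs_le.1 (h₁ x)
  have e₂ := abs_le.1 (h₂ x)
  set B := c₁ ^ 2 * Real.sqrt (c₂ * l) * Real.sqrt β * (N : ℝ) ^ (-(1 / 2 : ℝ) - 3 / (2 * β)) *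
    Real.sqrt (Real.log N) with hB
  have hB0 : 0 ≤ B := by positivity
  rw [show 7 * (c₁ ^ 2 * Real.sqrt (c₂ * l) * Real.sqrt β) *
    (N : ℝ) ^ (-(1 / 2 : ℝ) - 3 / (2 * β)) * Real.sqrt (Real.log N) = 7 * B by rw [hB]; ring]
    at e₁ e₂
  rw [show 45 * (8 * c₁ ^ 2 * Real.sqrt (c₂ * (l : ℝ)) * Real.sqrt β) *
    (N : ℝ) ^ (-(1 / 2 : ℝ) - 3 / (2 * β)) * Real.sqrt (Real.log (N : ℝ)) = 360 * B by
      rw [hB]; ring]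
  rw [abs_le]
  -- The two halves cost `7 * B` each, well below `360 * B`.
  constructor <;> linarith [e₁.1, e₁.2, e₂.1, e₂.2]
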